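/- **Theorem.** Let $G=(V,E,P,L)$ be a finite game graph: $V=V_0\sqcup V_1$ is a non-empty set of $n$ states, player 0 moves in $V_0$ and player 1 in $V_1$, every state has an $E$-successor, and $L:V\to 2^P$ labels the states by sets of atomic propositions. Let $M_1,\dots,M_m\in P$ be modes and $T_{i,1},\dots,T_{i,t_i}\in P$ the targets of mode $i$, where $\max_i t_i\ge 1$, and assume that the modes are mutually exclusive: $M_i\in L(v)$ implies $M_j\notin L(v)$ for all $j\ne i$ and $v\in V$. In the mode-target game on $G$ player 0 wins a play iff its label sequence satisfies the LTL formula $$\varphi=\bigwedge_{i=1}^m\Big(\Diamond\square M_i\implies\bigvee_{j=1}^{t_i}\Diamond\square T_{i,j}\Big),$$ and the winning set $\llbracket\varphi\rrbracket$ consists of the states from which player 0 has a winning strategy. Put $\bar T_{i,j}=T_{i,j}$ for $j\le t_i$ and $\bar T_{i,j}=\mathtt{false}$ for $j>t_i$, let $$\mathrm{Pre}(S)=\{v\in V_0:\exists v'\in S,\ (v,v')\in E\}\cup\{v\in V_1:\forall v',\ (v,v')\in E\Rightarrow v'\in S\},$$ and write $\llbracket p\rrbracket$ for the set of states in which a Boolean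 combination $p$ of atomic propositions holds. Consider the fixed point $$W=\nu Z\bigcap_{i=1}^m\mu Y\bigcup_{j=1}^{\max_i t_i}\nu X\Big(\big(\mathrm{Pre}(X)\cap\bigcup_{\ell=1}^m\llbracket M_\ell\wedge\bar T_{\ell,j}\rrbracket\big)\cup\mathrm{Pre}(Y)\cup\big(\llbracket\neg M_i\rrbracket\cap\mathrm{Pre}(Z)\big)\Big).$$ Let GR(1)-Emb be the symbolic algorithm (which accesses $E$ only through $\mathrm{Pre}$ computations) that evaluates this expression by nested iteration: the iterations over $Z$ and $Y$ start from $V$ and $\varnothing$, respectively, each iteration stops when its set no longer changes, and the iteration over $X$ for the indices $i,j$ and the $l$-th iterate of $Y$ starts from the value most recently computed for the same $i,j,l$ (at an earlier iterate of $Z$), or from $V$ if there is none. Then GR(1)-Emb solves the mode-target game: its output is $W$, and $W=\llbracket\varphi\rrbracket$, which is also the winning set of the GR(1) game on $G$ with winning condition $$\Big(\bigwedge_{j=1}^{\max_i t_i}\square\Diamond\bigwedge_{i=1}^m(\neg M_i\vee\neg\bar T_{i,j})\Big)\implies\bigwedge_{i=1}^m\square\Diamond\neg M_i .$$ Moreover,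 it makes $O(m\cdot\max_i t_i\cdot n^2)$ $\mathrm{Pre}$ computations: there is an absolute constant $C$ such that for all such games their number is at most $C\,m\,(\max_i t_i)\,n^2$. -/

import Mathlib

namespace ModeTarget

universe u v

/-! ### Linear temporal logic -/

/-- LTL formulas over the atomic propositions `P`.  The constant `tru` (an abbreviation of
`¬ φ ∨ φ` as soon as there is some formula) is a constructor, so that empty conjunctions and
disjunctions and the constant `false` make sense over every `P`. -/
inductive LTL (P : Type v) : Type v
  | tru : LTL P
  | atom (p : P) : LTL P
  | neg (φ : LTL P) : LTL P
  | or (φ ψ : LTL P) : LTL P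
  | next (φ : LTL P) : LTL P
  | untl (φ ψ : LTL P) : LTL P

namespace LTL

variable {P : Type v}

def fls : LTL P := neg tru

def and (φ ψ : LTL P) : LTL P := neg (or (neg φ) (neg ψ))

def imp (φ ψ : LTL P) : LTL P := or (neg φ) ψ

/-- `◇ φ` -/
def ev (φ : LTL P) : LTL P := untl tru φ

/-- `□ φ` -/
def alw (φ : LTL P) : LTL P := neg (ev (neg φ))

/-- `φ 0 ∧ ⋯ ∧ φ (k - 1)` -/
def bigAnd {k : ℕ} (φ : Fin k → LTL P) : LTL P := (List.ofFn φ).foldr and tru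

/-- `φ 0 ∨ ⋯ ∨ φ (k - 1)` -/
def bigOr {k : ℕ} (φ : Fin k → LTL P) : LTL P := (List.ofFn φ).foldr or fls

/-- `Sat w φ i`: the infinite word `w` over the alphabet `2 ^ P` satisfies `φ` at time `i`. -/
def Sat (w : ℕ → Finset P) : LTL P → ℕ → Prop
  | tru, _ => True
  | atom p, i => p ∈ w i
  | neg φ, i => ¬ Sat w φ i
  | or φ ψ, i => Sat w φ i ∨ Sat w ψ i
  | next φ, i => Sat w φ (i + 1)
  | untl φ ψ, i => ∃ k, i ≤ k ∧ Sat w ψ k ∧ ∀ j, i ≤ j → j < k → Sat w φ j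

end LTL

/-! ### Game graphs, strategies, winning sets -/

/-- A game graph on the state set `V`, labeled by sets of atomic propositions from `P`.
Player 0 moves in the states of `V0`, player 1 in all other states; every state has a
successor. -/
structure GameGraph (V : Type u) (P : Type v) where
  V0 : Finset V
  E : Finset (V × V)
  label : V → Finset P
  exists_succ : ∀ v, ∃ v', (v, v') ∈ E

namespace GameGraph

variable {V : Type u} {P : Type v}

/-- Plays are the infinite paths of the game graph. -/
def IsPlay (G : GameGraph V P) (r : ℕ → V) : Prop :=
  ∀ k, (r k, r (k + 1)) ∈ G.E

/-- A (possibly partial) strategy of player 0 maps a history and a current state to a successor of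
the current state.  Only its values at current states in `V0` matter. -/
def IsStrategy (G : GameGraph V P) (f : List V → V → Option V) : Prop :=
  ∀ h, ∀ v ∈ G.V0, ∀ v', f h v = some v' → (v, v') ∈ G.E

/-- The play `r` follows `f`: whenever player 0 is to move and `f` is defined on the history, the
play takes the move prescribed by `f`.  (Where `f` is undefined, every move is allowed, so a
strategy never wins by refusing to move.) -/
def Follows (G : GameGraph V P) (f : List V → V → Option V) (r : ℕ → V) : Prop :=
  ∀ k, r k ∈ G.V0 → ∀ v', f ((List.range k).map r) (r k) = some v' → r (k + 1) = v'

/-- The strategy `f` of player 0 is winning from `v` in the LTL game `(G, φ)`. -/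
def IsWinningFrom (G : GameGraph V P) (φ : LTL P) (f : List V → V → Option V) (v : V) : Prop :=
  ∀ r : ℕ → V, G.IsPlay r → r 0 = v → G.Follows f r → LTL.Sat (fun k => G.label (r k)) φ 0

variable [Fintype V] [DecidableEq V]

open Classical in
/-- The set of states from which player 0 has a winning strategy in the LTL game `(G, φ)`. -/
noncomputable def winningSet (G : GameGraph V P) (φ : LTL P) : Finset V :=
  Finset.univ.filter fun v => ∃ f, G.IsStrategy f ∧ G.IsWinningFrom φ f v

/-- The states from which player 0 can force the next state to lie in `S`. -/
def pre (G : GameGraph V P) (S : Finset V) : Finset V :=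
  Finset.univ.filter fun v =>
    (v ∈ G.V0 ∧ ∃ v' ∈ S, (v, v') ∈ G.E) ∨ (v ∉ G.V0 ∧ ∀ v', (v, v') ∈ G.E → v' ∈ S)

end GameGraph

/-! ### Mode-target games and their embedding into GR(1) games -/

section ModeTargetGames

variable {V : Type u} {P : Type v} {m : ℕ} {t : Fin m → ℕ}

/-- Modes are mutually exclusive. -/
def ModesExclusive (G : GameGraph V P) (M : Fin m → P) : Prop :=
  ∀ v i, M i ∈ G.label v → ∀ j, j ≠ i → M j ∉ G.label v

/-- The mode-target formula `⋀ i, (◇ □ M i → ⋁ j, ◇ □ T i j)`. -/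
def mtFormula (M : Fin m → P) (T : (i : Fin m) → Fin (t i) → P) : LTL P :=
  .bigAnd fun i =>
    .imp (.ev (.alw (.atom (M i)))) (.bigOr fun j => .ev (.alw (.atom (T i j))))

/-- The largest number of targets of a mode. -/
def maxTargets (t : Fin m → ℕ) : ℕ := Finset.univ.sup t

/-- `T i j`, continued by `false` for `j ≥ t i`. -/
def paddedTarget (T : (i : Fin m) → Fin (t i) → P) (i : Fin m) (j : ℕ) : LTL P :=
  if h : j < t i then .atom (T i ⟨j, h⟩) else .fls

/-- The GR(1) formula
`(⋀ j, □ ◇ ⋀ i, (¬ M i ∨ ¬ T i j)) → ⋀ i, □ ◇ ¬ M i`, with padded targets. -/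
def gr1Formula (M : Fin m → P) (T : (i : Fin m) → Fin (t i) → P) : LTL P :=
  .imp
    (.bigAnd fun j : Fin (maxTargets t) =>
      .alw (.ev (.bigAnd fun i => .or (.neg (.atom (M i))) (.neg (paddedTarget T i j)))))
    (.bigAnd fun i => .alw (.ev (.neg (.atom (M i)))))

variable [Fintype V] [DecidableEq V] [DecidableEq P]

/-- The states in which `¬ M i` holds. -/
def notModeStates (G : GameGraph V P) (M : Fin m → P) (i : Fin m) : Finset V :=
  Finset.univ.filter fun v => M i ∉ G.label v

/-- The states in which `M l ∧ T l j` holds for some mode `l`, with padded targets. -/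
def onTargetStates (G : GameGraph V P) (M : Fin m → P) (T : (i : Fin m) → Fin (t i) → P)
    (j : ℕ) : Finset V :=
  Finset.univ.filter fun v =>
    ∃ l, M l ∈ G.label v ∧ ∃ h : j < t l, T l ⟨j, h⟩ ∈ G.label v

end ModeTargetGames

/-! ### Fixed points -/

section FixedPoints

variable {V : Type u} [Fintype V] [DecidableEq V]

open Classical in
/-- `ν X, F X = ⋂ k, F^k (V)` -/
noncomputable def nuFix (F : Finset V → Finset V) : Finset V :=
  Finset.univ.filter fun v => ∀ k : ℕ, v ∈ F^[k] Finset.univ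

open Classical in
/-- `μ X, F X = ⋃ k, F^k (∅)` -/
noncomputable def muFix (F : Finset V → Finset V) : Finset V :=
  Finset.univ.filter fun v => ∃ k : ℕ, v ∈ F^[k] ∅

variable {P : Type v} [DecidableEq P] {m : ℕ} {t : Fin m → ℕ}

/-- The fixed-point expression that describes the winning set of the embedded GR(1) game:
`ν Z, ⋂ i, μ Y, ⋃ j, ν X, (Pre X ∩ ⋃ l, ⟦M l ∧ T l j⟧) ∪ Pre Y ∪ (⟦¬ M i⟧ ∩ Pre Z)`. -/
noncomputable def gr1EmbFixedPoint (G : GameGraph V P) (M : Fin m → P)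
    (T : (i : Fin m) → Fin (t i) → P) : Finset V :=
  nuFix fun Z => Finset.univ.inf fun i : Fin m =>
    muFix fun Y => Finset.univ.sup fun j : Fin (maxTargets t) =>
      nuFix fun X =>
        (G.pre X ∩ onTargetStates G M T j) ∪ G.pre Y ∪ (notModeStates G M i ∩ G.pre Z)

end FixedPoints

/-! ### Symbolic algorithms: programs that know the game moves only through `Pre` -/

/-- A symbolic program on sets of states: it either returns a value, or asks for the value of
`Pre` on a set and continues with the answer. -/
inductive SymProg (V : Type u) (α : Type u) : Type u
  | ret (a : α) : SymProg V α
  | query (S : Finset V) (next : Finset V → SymProg V α) : SymProg V α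

namespace SymProg

variable {V : Type u} {α β : Type u}

def bind : SymProg V α → (α → SymProg V β) → SymProg V β
  | ret a, f => f a
  | query S next, f => query S fun R => (next R).bind f

instance : Monad (SymProg V) where
  pure := ret
  bind := bind

/-- Compute `Pre S`. -/
def askPre (S : Finset V) : SymProg V (Finset V) := query S ret

/-- The value returned by a program when `Pre` is the given operator. -/
def result (pre : Finset V → Finset V) : SymProg V α → α
  | ret a => a
  | query S next => result pre (next (pre S))

/-- The number of `Pre` computations made by a program when `Pre` is the given operator. -/
def preCount (pre : Finset V → Finset V) : SymProg V α → ℕ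
  | ret _ => 0
  | query S next => preCount pre (next (pre S)) + 1

/-- Run finitely many programs one after the other and collect their values. -/
def runAll : {k : ℕ} → (Fin k → SymProg V α) → SymProg V (Fin k → α)
  | 0, _ => ret Fin.elim0
  | _ + 1, p => do
      let a ← p 0
      let b ← runAll fun i => p i.succ
      return Fin.cons a b

end SymProg

/-! ### The algorithm GR(1)-Emb

The nested iteration for
`ν Z, ⋂ i, μ Y, ⋃ j, ν X, (Pre X ∩ b j) ∪ Pre Y ∪ (g i ∩ Pre Z)`.
The iterations over `Z` and `Y` start from the full and the empty set.  The iteration over `X` for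
the guarantee `i`, the assumption `j` and the `l`-th iterate of `Y` starts from the value that was
computed for the same `i`, `j`, `l` at the last earlier iterate of `Z` for which there is one, and
from the full set otherwise.  Each loop stops as soon as its set does not change any more; the
first numeral argument bounds the number of rounds (an iteration of monotone operators on `n`
states is stable after `n` rounds, so that `n + 1` rounds always suffice). -/

section Algorithm

variable {V : Type u} [Fintype V] [DecidableEq V]

/-- Iterate `X ↦ (Pre X ∩ b) ∪ c` from `X` until it is stable. -/
def nuXLoop (b c : Finset V) : ℕ → Finset V → SymProg V (Finset V)
  | 0, X => return X
  | rounds + 1, X => do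
      let R ← SymProg.askPre X
      let X' := (R ∩ b) ∪ c
      if X' = X then return X else nuXLoop b c rounds X'

/-- Iterate `Y ↦ ⋃ j, ν X, (Pre X ∩ b j) ∪ Pre Y ∪ c` from `Y`, the `l`-th iterate, until it is
stable.  The table `mem` holds, for each `l` and `j`, the value from which the iteration over `X`
starts; the updated table is returned along with the limit. -/
def muYLoop {k : ℕ} (b : Fin k → Finset V) (c : Finset V) :
    ℕ → ℕ → Finset V → (ℕ → Fin k → Finset V) →
      SymProg V (Finset V × (ℕ → Fin k → Finset V))
  | 0, _, Y, mem => return (Y, mem)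
  | rounds + 1, l, Y, mem => do
      let R ← SymProg.askPre Y
      let Xs ← SymProg.runAll fun j =>
        nuXLoop (b j) (R ∪ c) (Fintype.card V + 1) (mem l j)
      let Y' := Finset.univ.sup Xs
      let mem' := Function.update mem l Xs
      if Y' = Y then return (Y, mem') else muYLoop b c rounds (l + 1) Y' mem'

/-- Iterate `Z ↦ ⋂ i, μ Y, ⋃ j, ν X, (Pre X ∩ b j) ∪ Pre Y ∪ (g i ∩ Pre Z)` from `Z` until it is
stable; `mem i` is the table used for the guarantee `i`. -/
def nuZLoop {m k : ℕ} (b : Fin k → Finset V) (g : Fin m → Finset V) :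
    ℕ → Finset V → (Fin m → ℕ → Fin k → Finset V) → SymProg V (Finset V)
  | 0, Z, _ => return Z
  | rounds + 1, Z, mem => do
      let R ← SymProg.askPre Z
      let out ← SymProg.runAll fun i =>
        muYLoop b (g i ∩ R) (Fintype.card V + 1) 0 ∅ (mem i)
      let Z' := Finset.univ.inf fun i => (out i).1
      if Z' = Z then return Z else nuZLoop b g rounds Z' fun i => (out i).2

/-- The symbolic GR(1) algorithm for negated assumptions `b` and guarantees `g`. -/
def gr1Algorithm {m k : ℕ} (b : Fin k → Finset V) (g : Fin m → Finset V) :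
    SymProg V (Finset V) :=
  nuZLoop b g (Fintype.card V + 1) Finset.univ fun _ _ _ => Finset.univ

variable {P : Type v} [DecidableEq P] {m : ℕ} {t : Fin m → ℕ}

/-- The algorithm GR(1)-Emb: the GR(1) algorithm for the embedded GR(1) game. -/
def gr1Emb (G : GameGraph V P) (M : Fin m → P) (T : (i : Fin m) → Fin (t i) → P) :
    SymProg V (Finset V) :=
  gr1Algorithm (fun j : Fin (maxTargets t) => onTargetStates G M T j) (notModeStates G M)

end Algorithm

end ModeTarget

open ModeTarget

namespace ModeTarget

universe u v

/-! ### Fixed points of monotone operators on finite sets -/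

section FixedPointLemmas

variable {V : Type u} [Fintype V] {F H : Finset V → Finset V}

/-! The two winning conditions agree play by play. If mode `i` holds forever from some time on,
exclusivity makes it the only mode from then on, so "some `M l ∧ T l j` holds" reduces to `T i j`.
Refuting every `◇□ T i j` is then the same as satisfying every GR(1) assumption, with the guarantee
`□◇ ¬ M i` violated (`sat_mtFormula_iff_sat_gr1Formula`). Only this step needs exclusivity.

The GR(1) game is solved by ranks on the nested fixed point. Inside `W`, player 0 pursues the
guarantees cyclically; the first inner greatest fixed point containing the state is a rank that
never increases between two guarantees, and where it stalls the play stays in one `b j`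
(`exists_strategy_of_mem_nuFix`). Outside `W`, the iterates of `Z` and `X` that exclude the state
give ranks for a play spoiling any given strategy (`exists_play_of_notMem_nuFix`).

For the cost, the total size of the tables of stored `X`-values is a potential. A warm-started
`X`-loop pays for all but one of its queries by shrinking its entry, so all descents of the run
together cost at most the initial size `m (n + 1) k n`, where `k` is the number of assumptions. What
remains is a constant number of queries per loop round or loop call, again `O(m k n²)`
(`nuXLoop_spec`, `muYLoop_spec`, `nuZLoop_spec`). -/

theorem mem_nuFix {v : V} : v ∈ nuFix F ↔ ∀ k : ℕ, v ∈ F^[k] Finset.univ := by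
  simp [nuFix]

theorem mem_muFix {v : V} : v ∈ muFix F ↔ ∃ k : ℕ, v ∈ F^[k] ∅ := by
  simp [muFix]

theorem nuFix_le_iterate (k : ℕ) : nuFix F ≤ F^[k] Finset.univ :=
  fun _ hv => mem_nuFix.1 hv k

theorem iterate_le_muFix (k : ℕ) : F^[k] ∅ ≤ muFix F :=
  fun _ hv => mem_muFix.2 ⟨k, hv⟩

theorem le_nuFix (hF : Monotone F) {S : Finset V} (hS : S ≤ F S) : S ≤ nuFix F := by
  have h : ∀ k, S ≤ F^[k] Finset.univ := by
    intro k
    induction k with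
    | zero => exact Finset.subset_univ S
    | succ k ih => rw [Function.iterate_succ_apply']; exact hS.trans (hF ih)
  exact fun v hv => mem_nuFix.2 fun k => h k hv

theorem muFix_le (hF : Monotone F) {S : Finset V} (hS : F S ≤ S) : muFix F ≤ S := by
  have h : ∀ k, F^[k] ∅ ≤ S := by
    intro k
    induction k with
    | zero => exact Finset.empty_subset S
    | succ k ih => rw [Function.iterate_succ_apply']; exact (hF ih).trans hS
  intro v hv
  obtain ⟨k, hk⟩ := mem_muFix.1 hv
  exact h k hk

theorem iterate_univ_succ_le (hF : Monotone F) (k : ℕ) :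
    F^[k + 1] Finset.univ ≤ F^[k] Finset.univ :=
  hF.antitone_iterate_of_map_le (Finset.subset_univ _) k.le_succ

omit [Fintype V] in
theorem iterate_empty_le_succ (hF : Monotone F) (k : ℕ) : F^[k] ∅ ≤ F^[k + 1] ∅ :=
  hF.monotone_iterate_of_le_map (Finset.empty_subset _) k.le_succ

theorem nuFix_eq_iterate_of_stable (hF : Monotone F) {l : ℕ}
    (h : F (F^[l] Finset.univ) = F^[l] Finset.univ) : nuFix F = F^[l] Finset.univ :=
  le_antisymm (nuFix_le_iterate l) (le_nuFix hF h.ge)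

theorem muFix_eq_iterate_of_stable (hF : Monotone F) {l : ℕ}
    (h : F (F^[l] ∅) = F^[l] ∅) : muFix F = F^[l] ∅ :=
  le_antisymm (muFix_le hF h.le) (iterate_le_muFix l)

/-- Each unstable iterate loses a state, which can happen at most `card V` times. -/
theorem exists_stable_iterate_univ (hF : Monotone F) :
    ∃ l ≤ Fintype.card V, F (F^[l] Finset.univ) = F^[l] Finset.univ := by
  by_contra! hne
  have h : ∀ l ≤ Fintype.card V + 1, (F^[l] Finset.univ).card + l ≤ Fintype.card V := by
    intro l
    induction l with
    | zero => intro _; exact (Finset.card_univ).le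
    | succ l ih =>
      intro hl
      have hlt : F^[l + 1] Finset.univ < F^[l] Finset.univ :=
        lt_of_le_of_ne (iterate_univ_succ_le hF l) <| by
          rw [Function.iterate_succ_apply']; exact hne l (by omega)
      have := Finset.card_lt_card hlt
      have := ih (by omega)
      omega
  have := h _ le_rfl
  omega

theorem exists_stable_iterate_empty (hF : Monotone F) :
    ∃ l ≤ Fintype.card V, F (F^[l] ∅) = F^[l] ∅ := by
  by_contra! hne
  have h : ∀ l ≤ Fintype.card V + 1, l ≤ (F^[l] ∅).card := by
    intro l
    induction l with
    | zero => simp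
    | succ l ih =>
      intro hl
      have hlt : F^[l] ∅ < F^[l + 1] ∅ :=
        lt_of_le_of_ne (iterate_empty_le_succ hF l) <| by
          rw [Function.iterate_succ_apply']; exact (hne l (by omega)).symm
      have := Finset.card_lt_card hlt
      have := ih (by omega)
      omega
  have := h _ le_rfl
  have := Finset.card_le_univ (F^[Fintype.card V + 1] ∅)
  omega

theorem map_nuFix (hF : Monotone F) : F (nuFix F) = nuFix F := by
  obtain ⟨l, -, hl⟩ := exists_stable_iterate_univ hF
  rw [nuFix_eq_iterate_of_stable hF hl, hl]

theorem map_muFix (hF : Monotone F) : F (muFix F) = muFix F := by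
  obtain ⟨l, -, hl⟩ := exists_stable_iterate_empty hF
  rw [muFix_eq_iterate_of_stable hF hl, hl]

/-- This and its dual settle the loops that exhaust their round budget. -/
theorem nuFix_eq_iterate (hF : Monotone F) {k : ℕ} (hk : Fintype.card V ≤ k) :
    nuFix F = F^[k] Finset.univ := by
  obtain ⟨l, hl, hs⟩ := exists_stable_iterate_univ hF
  rw [nuFix_eq_iterate_of_stable hF hs]
  obtain ⟨d, rfl⟩ := Nat.exists_eq_add_of_le' (hl.trans hk)
  rw [Function.iterate_add_apply, Function.iterate_fixed hs]

theorem muFix_eq_iterate (hF : Monotone F) {k : ℕ} (hk : Fintype.card V ≤ k) :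
    muFix F = F^[k] ∅ := by
  obtain ⟨l, hl, hs⟩ := exists_stable_iterate_empty hF
  rw [muFix_eq_iterate_of_stable hF hs]
  obtain ⟨d, rfl⟩ := Nat.exists_eq_add_of_le' (hl.trans hk)
  rw [Function.iterate_add_apply, Function.iterate_fixed hs]

theorem nuFix_mono (hF : Monotone F) (hH : Monotone H) (h : ∀ S, F S ≤ H S) :
    nuFix F ≤ nuFix H :=
  le_nuFix hH ((map_nuFix hF).ge.trans (h _))

theorem muFix_mono (hF : Monotone F) (hH : Monotone H) (h : ∀ S, F S ≤ H S) :
    muFix F ≤ muFix H :=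
  muFix_le hF ((h _).trans (map_muFix hH).le)

end FixedPointLemmas

/-! ### The operators of the GR(1) fixed point -/

section Operators

variable {V : Type u} [Fintype V] [DecidableEq V] {m k : ℕ}

/-- `X ↦ (Pre X ∩ b) ∪ c` -/
def nuXStep (pre : Finset V → Finset V) (b c X : Finset V) : Finset V :=
  (pre X ∩ b) ∪ c

/-- `Y ↦ ⋃ j, ν X, (Pre X ∩ b j) ∪ Pre Y ∪ c` -/
noncomputable def muYStep (pre : Finset V → Finset V) (b : Fin k → Finset V) (c Y : Finset V) :
    Finset V :=
  Finset.univ.sup fun j => nuFix (nuXStep pre (b j) (pre Y ∪ c))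

/-- `Z ↦ ⋂ i, μ Y, ⋃ j, ν X, (Pre X ∩ b j) ∪ Pre Y ∪ (g i ∩ Pre Z)` -/
noncomputable def nuZStep (pre : Finset V → Finset V) (b : Fin k → Finset V)
    (g : Fin m → Finset V) (Z : Finset V) : Finset V :=
  Finset.univ.inf fun i => muFix (muYStep pre b (g i ∩ pre Z))

variable {pre : Finset V → Finset V} (hpre : Monotone pre)
include hpre

omit [Fintype V] in
theorem nuXStep_le_nuXStep {b c c' X X' : Finset V} (hc : c ≤ c') (hX : X ≤ X') :
    nuXStep pre b c X ≤ nuXStep pre b c' X' :=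
  Finset.union_subset_union (Finset.inter_subset_inter (hpre hX) le_rfl) hc

omit [Fintype V] in
theorem monotone_nuXStep (b c : Finset V) : Monotone (nuXStep pre b c) :=
  fun _ _ h => nuXStep_le_nuXStep hpre le_rfl h

theorem nuFix_nuXStep_mono (b : Finset V) {c c' : Finset V} (hc : c ≤ c') :
    nuFix (nuXStep pre b c) ≤ nuFix (nuXStep pre b c') :=
  nuFix_mono (monotone_nuXStep hpre b c) (monotone_nuXStep hpre b c') fun _ =>
    nuXStep_le_nuXStep hpre hc le_rfl

theorem muYStep_le_muYStep (b : Fin k → Finset V) {c c' Y Y' : Finset V} (hc : c ≤ c')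
    (hY : Y ≤ Y') : muYStep pre b c Y ≤ muYStep pre b c' Y' :=
  Finset.sup_mono_fun fun _ _ =>
    nuFix_nuXStep_mono hpre _ (Finset.union_subset_union (hpre hY) hc)

theorem monotone_muYStep (b : Fin k → Finset V) (c : Finset V) : Monotone (muYStep pre b c) :=
  fun _ _ h => muYStep_le_muYStep hpre b le_rfl h

theorem muYStep_iterate_mono (b : Fin k → Finset V) {c c' : Finset V} (hc : c ≤ c') (l : ℕ) :
    (muYStep pre b c)^[l] ∅ ≤ (muYStep pre b c')^[l] ∅ := by
  induction l with
  | zero => exact le_rfl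
  | succ l ih =>
    simp only [Function.iterate_succ_apply']
    exact muYStep_le_muYStep hpre b hc ih

theorem monotone_nuZStep (b : Fin k → Finset V) (g : Fin m → Finset V) :
    Monotone (nuZStep pre b g) := fun _ _ h =>
  Finset.inf_mono_fun fun _ _ =>
    muFix_mono (monotone_muYStep hpre b _) (monotone_muYStep hpre b _) fun _ =>
      muYStep_le_muYStep hpre b (Finset.inter_subset_inter le_rfl (hpre h)) le_rfl

end Operators

/-! ### Values and costs of symbolic programs -/

namespace SymProg

variable {V : Type u} {α β : Type u} (pre : Finset V → Finset V)

@[simp] theorem result_pure (a : α) : result pre (pure a : SymProg V α) = a := rfl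

@[simp] theorem preCount_pure (a : α) : preCount pre (pure a : SymProg V α) = 0 := rfl

@[simp] theorem result_askPre (S : Finset V) : result pre (askPre S) = pre S := rfl

@[simp] theorem preCount_askPre (S : Finset V) : preCount pre (askPre S) = 1 := rfl

@[simp] theorem result_bind (p : SymProg V α) (f : α → SymProg V β) :
    result pre (p >>= f) = result pre (f (result pre p)) := by
  change result pre (p.bind f) = _
  induction p with
  | ret a => rfl
  | query S next ih => exact ih _

@[simp] theorem preCount_bind (p : SymProg V α) (f : α → SymProg V β) :
    preCount pre (p >>= f) = preCount pre p + preCount pre (f (result pre p)) := by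
  change preCount pre (p.bind f) = _
  induction p with
  | ret a => exact (Nat.zero_add _).symm
  | query S next ih =>
    change preCount pre ((next (pre S)).bind f) + 1 = _
    rw [ih, preCount, result]
    omega

@[simp] theorem result_runAll {k : ℕ} (p : Fin k → SymProg V α) :
    result pre (runAll p) = fun i => result pre (p i) := by
  induction k with
  | zero => funext i; exact i.elim0
  | succ k ih =>
    simp only [runAll, result_bind, result_pure, ih]
    funext i
    refine Fin.cases ?_ (fun i => ?_) i <;> simp

@[simp] theorem preCount_runAll {k : ℕ} (p : Fin k → SymProg V α) :
    preCount pre (runAll p) = ∑ i, preCount pre (p i) := by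
  induction k with
  | zero => rfl
  | succ k ih =>
    simp only [runAll, preCount_bind, preCount_pure, ih, Fin.sum_univ_succ, add_zero]

end SymProg

/-! ### Correctness and cost of the algorithm -/

section AlgorithmLemmas

open SymProg

variable {V : Type u} [Fintype V] [DecidableEq V] {m k : ℕ}
  {pre : Finset V → Finset V} (hpre : Monotone pre)

include hpre in
-- Every unstable round removes a state, and one last query confirms stability. With the size of the
-- limit on the left, the bounds telescope when the limit becomes the next starting value.
theorem nuXLoop_spec (b c : Finset V) (rounds : ℕ) (X : Finset V)
    (hX : nuXStep pre b c X ≤ X) (hlim : nuFix (nuXStep pre b c) ≤ X) (hr : X.card < rounds) :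
    (nuXLoop b c rounds X).result pre = nuFix (nuXStep pre b c) ∧
      (nuXLoop b c rounds X).preCount pre + (nuFix (nuXStep pre b c)).card ≤ X.card + 1 := by
  induction rounds generalizing X with
  | zero => omega
  | succ rounds ih =>
    have hmono := monotone_nuXStep hpre b c
    have hres : (nuXLoop b c (rounds + 1) X).result pre =
        SymProg.result pre (if nuXStep pre b c X = X then ret X
          else nuXLoop b c rounds (nuXStep pre b c X)) := rfl
    have hcount : (nuXLoop b c (rounds + 1) X).preCount pre =
        SymProg.preCount pre (if nuXStep pre b c X = X then ret X
          else nuXLoop b c rounds (nuXStep pre b c X)) + 1 := rfl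
    rw [hres, hcount]
    by_cases h : nuXStep pre b c X = X
    · have hfix : nuFix (nuXStep pre b c) = X := le_antisymm hlim (le_nuFix hmono h.ge)
      rw [if_pos h, hfix]
      exact ⟨rfl, by rw [preCount]; omega⟩
    · have hcard := Finset.card_lt_card (lt_of_le_of_ne hX h)
      obtain ⟨h1, h2⟩ := ih (nuXStep pre b c X) (hmono hX)
        ((map_nuFix hmono).ge.trans (hmono hlim)) (by omega)
      rw [if_neg h]
      exact ⟨h1, by omega⟩

/-- The stored values of a table are pre-fixed points above the greatest fixed points that the
iterations over `X` have to compute. -/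
def TableAbove (pre : Finset V → Finset V) (b : Fin k → Finset V) (c : Finset V)
    (mem : ℕ → Fin k → Finset V) : Prop :=
  ∀ l j, nuXStep pre (b j) (pre ((muYStep pre b c)^[l] ∅) ∪ c) (mem l j) ≤ mem l j ∧
    nuFix (nuXStep pre (b j) (pre ((muYStep pre b c)^[l] ∅) ∪ c)) ≤ mem l j

include hpre in
-- The soundness of warm starts: as `Z` shrinks, so do `c` and every iterate of `Y`. A value stored
-- for the larger operator is thus still a pre-fixed point of the smaller one and above its greatest
-- fixed point.
theorem TableAbove.anti {b : Fin k → Finset V} {c c' : Finset V} {mem : ℕ → Fin k → Finset V}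
    (h : TableAbove pre b c mem) (hc : c' ≤ c) : TableAbove pre b c' mem := by
  intro l j
  have hle : pre ((muYStep pre b c')^[l] ∅) ∪ c' ≤ pre ((muYStep pre b c)^[l] ∅) ∪ c :=
    Finset.union_subset_union (hpre (muYStep_iterate_mono hpre b hc l)) hc
  exact ⟨(nuXStep_le_nuXStep hpre hle le_rfl).trans (h l j).1,
    (nuFix_nuXStep_mono hpre _ hle).trans (h l j).2⟩

/-- The total size of the entries of a table that are ever used. -/
def tableSize (mem : ℕ → Fin k → Finset V) : ℕ :=
  ∑ l ∈ Finset.range (Fintype.card V + 1), ∑ j, (mem l j).card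

omit [DecidableEq V] in
theorem tableSize_update (mem : ℕ → Fin k → Finset V) {l : ℕ} (hl : l < Fintype.card V + 1)
    (Xs : Fin k → Finset V) :
    tableSize (Function.update mem l Xs) + ∑ j, (mem l j).card =
      tableSize mem + ∑ j, (Xs j).card := by
  have hmem := Finset.mem_range.2 hl
  unfold tableSize
  rw [← Finset.add_sum_erase _ _ hmem, ← Finset.add_sum_erase _ (fun l => ∑ j, (mem l j).card) hmem]
  have : ∑ x ∈ (Finset.range (Fintype.card V + 1)).erase l,
        ∑ j, (Function.update mem l Xs x j).card =
      ∑ x ∈ (Finset.range (Fintype.card V + 1)).erase l, ∑ j, (mem x j).card :=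
    Finset.sum_congr rfl fun x hx => by
      rw [Function.update_of_ne (Finset.ne_of_mem_erase hx)]
  rw [this, Function.update_self]
  omega

include hpre in
-- The table size acts as a potential: beyond its decrease, a round costs one query for `Pre Y` and
-- one stability check for each of the `k` loops over `X`. The relation `hr` keeps `l` among the
-- counted table rows and makes the iterate stable when the rounds run out.
theorem muYLoop_spec (b : Fin k → Finset V) (c : Finset V) (rounds l : ℕ) (Y : Finset V)
    (mem : ℕ → Fin k → Finset V) (hr : l + rounds = Fintype.card V + 1)
    (hY : Y = (muYStep pre b c)^[l] ∅) (hmem : TableAbove pre b c mem) :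
    ((muYLoop b c rounds l Y mem).result pre).1 = muFix (muYStep pre b c) ∧
      TableAbove pre b c ((muYLoop b c rounds l Y mem).result pre).2 ∧
      (muYLoop b c rounds l Y mem).preCount pre +
          tableSize ((muYLoop b c rounds l Y mem).result pre).2 ≤
        tableSize mem + rounds * (1 + k) := by
  have hmono := monotone_muYStep hpre b c
  induction rounds generalizing l Y mem with
  | zero =>
    refine ⟨?_, hmem, ?_⟩
    · rw [muFix_eq_iterate hmono (show Fintype.card V ≤ l by omega), ← hY]; rfl
    · change 0 + tableSize mem ≤ _
      omega
  | succ rounds ih =>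
    have hX := fun j => nuXLoop_spec hpre (b j) (pre Y ∪ c) (Fintype.card V + 1) (mem l j)
      (hY ▸ (hmem l j).1) (hY ▸ (hmem l j).2) (Nat.lt_succ_of_le (Finset.card_le_univ _))
    have hres : (fun j => (nuXLoop (b j) (pre Y ∪ c) (Fintype.card V + 1) (mem l j)).result pre) =
        fun j => nuFix (nuXStep pre (b j) (pre Y ∪ c)) := funext fun j => (hX j).1
    set Xs := fun j => nuFix (nuXStep pre (b j) (pre Y ∪ c)) with hXs
    have hcost : ∑ j, (nuXLoop (b j) (pre Y ∪ c) (Fintype.card V + 1) (mem l j)).preCount pre +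
        ∑ j, (Xs j).card ≤ ∑ j, (mem l j).card + k := by
      have := Finset.sum_le_sum fun j (_ : j ∈ Finset.univ) => (hX j).2
      simpa [Finset.sum_add_distrib] using this
    have hsize := tableSize_update mem (show l < Fintype.card V + 1 by omega) Xs
    have hmem' : TableAbove pre b c (Function.update mem l Xs) := by
      intro l' j
      rcases eq_or_ne l' l with rfl | hne
      · rw [Function.update_self, hXs, hY]
        exact ⟨(map_nuFix (monotone_nuXStep hpre _ _)).le, le_rfl⟩
      · rw [Function.update_of_ne hne]
        exact hmem l' j
    have hstep : Finset.univ.sup Xs = muYStep pre b c Y := rfl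
    have hmul : (rounds + 1) * (1 + k) = rounds * (1 + k) + (1 + k) := by ring
    simp only [muYLoop, result_bind, preCount_bind, result_askPre, preCount_askPre,
      result_runAll, preCount_runAll, hres]
    split_ifs with h
    · refine ⟨?_, hmem', ?_⟩
      · rw [muFix_eq_iterate_of_stable hmono (l := l) (by rw [← hY, ← hstep, h]), ← hY]
        rfl
      · simp only [preCount_pure, result_pure]
        omega
    · obtain ⟨h1, h2, h3⟩ := ih (l + 1) (Finset.univ.sup Xs) (Function.update mem l Xs) (by omega)
        (by rw [Function.iterate_succ_apply', ← hY, hstep]) hmem'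
      exact ⟨h1, h2, by omega⟩

include hpre in
-- The tables survive from one `Z` to the next, so their initial size is charged once and not once
-- per round.
theorem nuZLoop_spec (b : Fin k → Finset V) (g : Fin m → Finset V) (rounds r : ℕ) (Z : Finset V)
    (mem : Fin m → ℕ → Fin k → Finset V) (hr : r + rounds = Fintype.card V + 1)
    (hZ : Z = (nuZStep pre b g)^[r] Finset.univ)
    (hmem : ∀ i, TableAbove pre b (g i ∩ pre Z) (mem i)) :
    (nuZLoop b g rounds Z mem).result pre = nuFix (nuZStep pre b g) ∧
      (nuZLoop b g rounds Z mem).preCount pre ≤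
        ∑ i, tableSize (mem i) + rounds * (1 + m * ((Fintype.card V + 1) * (1 + k))) := by
  have hmono := monotone_nuZStep hpre b g
  induction rounds generalizing r Z mem with
  | zero =>
    refine ⟨?_, Nat.zero_le _⟩
    rw [nuFix_eq_iterate hmono (show Fintype.card V ≤ r by omega), ← hZ]; rfl
  | succ rounds ih =>
    have hY := fun i => muYLoop_spec hpre b (g i ∩ pre Z) (Fintype.card V + 1) 0 ∅ (mem i)
      (by omega) rfl (hmem i)
    have hcost := Finset.sum_le_sum fun i (_ : i ∈ Finset.univ) => (hY i).2.2
    simp only [Finset.sum_add_distrib, Finset.sum_const, Finset.card_univ, Fintype.card_fin,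
      smul_eq_mul] at hcost
    have hstep : (Finset.univ.inf fun i => ((muYLoop b (g i ∩ pre Z) (Fintype.card V + 1) 0 ∅
        (mem i)).result pre).1) = nuZStep pre b g Z := by
      simp only [fun i => (hY i).1, nuZStep]
    have hle : nuZStep pre b g Z ≤ Z := by
      rw [hZ, ← Function.iterate_succ_apply' (nuZStep pre b g) r]
      exact iterate_univ_succ_le hmono r
    set A := m * ((Fintype.card V + 1) * (1 + k))
    have hmul : (rounds + 1) * (1 + A) = rounds * (1 + A) + (1 + A) := by ring
    simp only [nuZLoop, result_bind, preCount_bind, result_askPre, preCount_askPre,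
      result_runAll, preCount_runAll, hstep]
    split_ifs with h
    · refine ⟨?_, ?_⟩
      · rw [nuFix_eq_iterate_of_stable hmono (l := r) (by rw [← hZ, h]), ← hZ]
        rfl
      · simp only [preCount_pure]
        omega
    · obtain ⟨h1, h2⟩ := ih (r + 1) (nuZStep pre b g Z)
        (fun i => ((muYLoop b (g i ∩ pre Z) (Fintype.card V + 1) 0 ∅ (mem i)).result pre).2)
        (by omega) (by rw [Function.iterate_succ_apply', ← hZ])
        (fun i => ((hY i).2.1).anti hpre (Finset.inter_subset_inter le_rfl (hpre hle)))
      exact ⟨h1, by omega⟩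

theorem tableAbove_univ (b : Fin k → Finset V) (c : Finset V) :
    TableAbove pre b c fun _ _ => Finset.univ :=
  fun _ _ => ⟨Finset.subset_univ _, Finset.subset_univ _⟩

include hpre in
theorem result_gr1Algorithm (b : Fin k → Finset V) (g : Fin m → Finset V) :
    (gr1Algorithm b g).result pre = nuFix (nuZStep pre b g) :=
  (nuZLoop_spec hpre b g _ 0 _ _ (Nat.zero_add _) rfl fun _ => tableAbove_univ _ _).1

include hpre in
theorem preCount_gr1Algorithm_le [Nonempty V] (b : Fin k → Finset V) (g : Fin m → Finset V)
    (hm : 0 < m) (hk : 0 < k) :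
    (gr1Algorithm b g).preCount pre ≤ 12 * (m * k * Fintype.card V ^ 2) := by
  refine (nuZLoop_spec hpre b g _ 0 _ _ (Nat.zero_add _) rfl
    fun _ => tableAbove_univ _ _).2.trans ?_
  simp only [tableSize, Finset.card_univ, Finset.sum_const, Finset.card_range, Fintype.card_fin,
    smul_eq_mul]
  generalize hn : Fintype.card V = n
  have hn1 : 1 ≤ n := hn ▸ Fintype.card_pos
  -- The constant is 2 for the initial tables, 2 for the queries on `Z`, and 8 for the rounds over
  -- `Y` with their stability checks.
  calc m * ((n + 1) * (k * n)) + (n + 1) * (1 + m * ((n + 1) * (1 + k)))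
      ≤ m * ((n + n) * (k * n)) + (n + n) * (m * k * n + m * ((n + n) * (k + k))) := by
        have : 1 ≤ m * k * n := Nat.mul_pos (Nat.mul_pos hm hk) hn1
        gcongr
        all_goals omega
    _ = 12 * (m * k * n ^ 2) := by ring

end AlgorithmLemmas

/-! ### Sequences of natural numbers -/

theorem eventually_eq_of_eventually_succ_le {f : ℕ → ℕ} {N : ℕ}
    (h : ∀ k ≥ N, f (k + 1) ≤ f k) : ∃ K ≥ N, ∀ k ≥ K, f k = f K := by
  classical
  have hex : ∃ x, ∃ K ≥ N, f K = x := ⟨_, N, le_rfl, rfl⟩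
  obtain ⟨K, hK, hx⟩ := Nat.find_spec hex
  have hmin : ∀ k ≥ N, f K ≤ f k := fun k hk => hx ▸ Nat.find_min' hex ⟨k, hk, rfl⟩
  refine ⟨K, hK, fun k hk => le_antisymm ?_ (hmin k (hK.trans hk))⟩
  induction k, hk using Nat.le_induction with
  | base => exact le_rfl
  | succ k hk ih => exact (h k (le_trans hK hk)).trans ih

/-- A counter that is incremented infinitely often and otherwise stays put leaves each of its
later values. -/
theorem exists_increment_of_infinitely_often {q : ℕ → ℕ}
    (hstep : ∀ k, q (k + 1) = q k ∨ q (k + 1) = q k + 1)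
    (hinf : ∀ N, ∃ k ≥ N, q (k + 1) = q k + 1) {N a : ℕ} (ha : q N ≤ a) :
    ∃ k ≥ N, q k = a ∧ q (k + 1) = q k + 1 := by
  classical
  have hex : ∃ n, N ≤ n ∧ a < q (n + 1) := by
    have hgrow : ∀ d, ∃ n ≥ N, d < q (n + 1) := by
      intro d
      induction d with
      | zero =>
        obtain ⟨n, hn, h⟩ := hinf N
        exact ⟨n, hn, by omega⟩
      | succ d ih =>
        obtain ⟨n, hn, h⟩ := ih
        obtain ⟨n', hn', h'⟩ := hinf (n + 1)
        have := monotone_nat_of_le_succ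
          (fun k => (hstep k).elim (fun h => h.ge) fun h => by omega) hn'
        exact ⟨n', by omega, by omega⟩
    exact hgrow a
  obtain ⟨hn, h⟩ := Nat.find_spec hex
  set n := Nat.find hex with hndef
  have hle : q n ≤ a := by
    rcases hn.eq_or_lt with hN | hN
    · rwa [← hN]
    · by_contra! hlt
      exact Nat.find_min hex (m := n - 1) (by omega)
        ⟨by omega, by rwa [Nat.sub_add_cancel (by omega)]⟩
  have := hstep n
  exact ⟨n, hn, by omega, by omega⟩

/-- A cyclic counter that is incremented infinitely often leaves each residue infinitely often. -/
theorem exists_increment_mod {q : ℕ → ℕ}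
    (hstep : ∀ k, q (k + 1) = q k ∨ q (k + 1) = q k + 1)
    (hinf : ∀ N, ∃ k ≥ N, q (k + 1) = q k + 1) {m : ℕ} (i : Fin m) (N : ℕ) :
    ∃ k ≥ N, q k % m = i ∧ q (k + 1) = q k + 1 := by
  -- The target `i + q N * m` has residue `i` and has not been passed at time `N`.
  have hle : q N ≤ i + q N * m :=
    (Nat.le_mul_of_pos_right _ i.pos).trans (Nat.le_add_left _ _)
  obtain ⟨k, hk, h, h'⟩ := exists_increment_of_infinitely_often hstep hinf hle
  refine ⟨k, hk, ?_, h'⟩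
  rw [h, Nat.add_mul_mod_self_right, Nat.mod_eq_of_lt i.isLt]

/-! ### Strategies and plays with memory -/

namespace GameGraph

variable {V : Type u} {P : Type v} [Fintype V] [DecidableEq V] (G : GameGraph V P)

theorem monotone_pre : Monotone G.pre := by
  intro S S' h v hv
  simp only [pre, Finset.mem_filter, Finset.mem_univ, true_and] at hv ⊢
  rcases hv with ⟨h0, v', hv', he⟩ | ⟨h1, hall⟩
  · exact Or.inl ⟨h0, v', h hv', he⟩
  · exact Or.inr ⟨h1, fun v' he => h (hall v' he)⟩

variable {G}

/-- A move out of `S` that agrees with the given strategy. -/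
theorem exists_move_of_notMem_pre {f : List V → V → Option V} (hf : G.IsStrategy f)
    {S : Finset V} {v : V} (hv : v ∉ G.pre S) (h : List V) :
    ∃ v' ∉ S, (v, v') ∈ G.E ∧ (v ∈ G.V0 → ∀ w, f h v = some w → v' = w) := by
  simp only [pre, Finset.mem_filter, Finset.mem_univ, true_and, not_or, not_and, not_exists,
    not_forall] at hv
  by_cases h0 : v ∈ G.V0
  · have hout : ∀ v', (v, v') ∈ G.E → v' ∉ S := fun v' he hS => hv.1 h0 v' hS he
    cases hw : f h v with
    | none =>
      obtain ⟨v', he⟩ := G.exists_succ v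
      exact ⟨v', hout v' he, he, by simp⟩
    | some w =>
      have he := hf h v h0 w hw
      exact ⟨w, hout w he, he, by simp⟩
  · obtain ⟨v', he, hS⟩ := hv.2 h0
    exact ⟨v', hS, he, fun h => absurd h h0⟩

/-- Player 0 can follow a local plan: in memory state `q` at `v` move into `S q v` and update the
memory to `upd q v`. -/
theorem exists_strategy_of_plan {Q : Type*} (q₀ : Q) (upd : Q → V → Q) (S : Q → V → Finset V)
    (Inv : Q → V → Prop)
    (h : ∀ q v, Inv q v → v ∈ G.pre (S q v) ∧ ∀ v' ∈ S q v, Inv (upd q v) v') :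
    ∃ f, G.IsStrategy f ∧ ∀ r, G.IsPlay r → Inv q₀ (r 0) → G.Follows f r →
      ∃ q : ℕ → Q, ∀ k, Inv (q k) (r k) ∧ q (k + 1) = upd (q k) (r k) ∧
        r (k + 1) ∈ S (q k) (r k) := by
  classical
  -- The memory is recomputed by folding `upd` over the history.
  let f : List V → V → Option V := fun hist v =>
    if hv : ∃ v' ∈ S (hist.foldl upd q₀) v, (v, v') ∈ G.E then some hv.choose else none
  refine ⟨f, ?_, ?_⟩
  · intro hist v _ v' hv'
    simp only [f] at hv'
    split_ifs at hv' with hex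
    cases hv'
    exact hex.choose_spec.2
  · intro r hr h0 hf
    let q : ℕ → Q := fun k => ((List.range k).map r).foldl upd q₀
    have hq : ∀ k, q (k + 1) = upd (q k) (r k) := by
      intro k
      simp [q, List.range_succ, List.foldl_append]
    have hmove : ∀ k, Inv (q k) (r k) → r (k + 1) ∈ S (q k) (r k) := by
      intro k hI
      have hp := (h _ _ hI).1
      simp only [pre, Finset.mem_filter, Finset.mem_univ, true_and] at hp
      rcases hp with ⟨hv0, hex⟩ | ⟨_, hall⟩
      · have := hf k hv0 hex.choose (by simp only [f]; exact dif_pos hex)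
        rw [this]
        exact hex.choose_spec.1
      · exact hall _ (hr k)
    have hI : ∀ k, Inv (q k) (r k) := by
      intro k
      induction k with
      | zero => exact h0
      | succ k ih => rw [hq]; exact (h _ _ ih).2 _ (hmove k ih)
    exact ⟨q, fun k => ⟨hI k, hq k, hmove k (hI k)⟩⟩

/-- Against any strategy of player 0, player 1 can follow a local plan that in each step avoids a
set which player 0 cannot force. -/
theorem exists_play_of_plan {Q : Type*} (Inv : Q → V → Prop) (R : Q → V → Q → V → Prop)
    (h : ∀ q v, Inv q v → ∃ S, v ∉ G.pre S ∧ ∀ v' ∉ S, ∃ q', Inv q' v' ∧ R q v q' v')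
    {f : List V → V → Option V} (hf : G.IsStrategy f) {q₀ : Q} {v₀ : V} (h₀ : Inv q₀ v₀) :
    ∃ r, G.IsPlay r ∧ r 0 = v₀ ∧ G.Follows f r ∧
      ∃ q : ℕ → Q, ∀ k, R (q k) (r k) (q (k + 1)) (r (k + 1)) := by
  have hnext : ∀ (hist : List V) (x : {x : Q × V // Inv x.1 x.2}),
      ∃ y : {x : Q × V // Inv x.1 x.2}, R x.1.1 x.1.2 y.1.1 y.1.2 ∧ (x.1.2, y.1.2) ∈ G.E ∧
        (x.1.2 ∈ G.V0 → ∀ w, f hist x.1.2 = some w → y.1.2 = w) := by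
    rintro hist ⟨⟨q, v⟩, hI⟩
    obtain ⟨S, hS, hq⟩ := h q v hI
    obtain ⟨v', hv', he, hw⟩ := exists_move_of_notMem_pre hf hS hist
    obtain ⟨q', hI', hR⟩ := hq v' hv'
    exact ⟨⟨⟨q', v'⟩, hI'⟩, hR, he, hw⟩
  choose next hR hE hF using hnext
  -- The history is carried along because the opposing strategy may depend on it.
  let s : ℕ → List V × {x : Q × V // Inv x.1 x.2} := fun k =>
    Nat.rec ([], ⟨(q₀, v₀), h₀⟩) (fun _ p => (p.1 ++ [p.2.1.2], next p.1 p.2)) k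
  have hs : ∀ k, s (k + 1) = ((s k).1 ++ [(s k).2.1.2], next (s k).1 (s k).2) := fun _ => rfl
  let r : ℕ → V := fun k => (s k).2.1.2
  have hhist : ∀ k, (s k).1 = (List.range k).map r := by
    intro k
    induction k with
    | zero => rfl
    | succ k ih => rw [hs, List.range_succ, List.map_append, ih]; rfl
  refine ⟨r, fun k => hE (s k).1 (s k).2, rfl, ?_, fun k => (s k).2.1.1,
    fun k => hR (s k).1 (s k).2⟩
  intro k h0 w hw
  exact hF (s k).1 (s k).2 h0 w (by rw [hhist]; exact hw)

end GameGraph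

/-! ### GR(1) games -/

section GR1

variable {V : Type u} {P : Type v} [Fintype V] [DecidableEq V] {G : GameGraph V P} {m k : ℕ}
  {b : Fin k → Finset V} {g : Fin m → Finset V}

/-- From the GR(1) fixed point, player 0 can force that all guarantees hold infinitely often or
some negated assumption holds from some point on. -/
theorem exists_strategy_of_mem_nuFix (hm : 0 < m) (hk : 0 < k) :
    ∃ f, G.IsStrategy f ∧ ∀ r, G.IsPlay r → r 0 ∈ nuFix (nuZStep G.pre b g) → G.Follows f r →
      (∀ i N, ∃ n ≥ N, r n ∈ g i) ∨ ∃ j N, ∀ n ≥ N, r n ∈ b j := by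
  classical
  set W := nuFix (nuZStep G.pre b g) with hW
  -- The memory is a counter whose residue mod `m` is the guarantee pursued. An index `N = j + l *
  -- k` encodes the assumption `j` and the `l`-th iterate of `Y`.
  let ι : ℕ → Fin m := fun q => ⟨q % m, Nat.mod_lt _ hm⟩
  let κ : ℕ → Fin k := fun N => ⟨N % k, Nat.mod_lt _ hk⟩
  let Y : Fin m → ℕ → Finset V := fun i l => (muYStep G.pre b (g i ∩ G.pre W))^[l] ∅
  -- The sets `X i N` list the greatest fixed points in the order of the iterates of `Y i`.
  let X : Fin m → ℕ → Finset V := fun i N =>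
    nuFix (nuXStep G.pre (b (κ N)) (G.pre (Y i (N / k)) ∪ (g i ∩ G.pre W)))
  have hX : ∀ i N, X i N = nuXStep G.pre (b (κ N)) (G.pre (Y i (N / k)) ∪ (g i ∩ G.pre W)) (X i N) :=
    fun i N => (map_nuFix (monotone_nuXStep G.monotone_pre _ _)).symm
  have hYX : ∀ i l v, v ∈ Y i l → ∃ N < l * k, v ∈ X i N := by
    intro i l v hv
    cases l with
    | zero => simp [Y] at hv
    | succ l =>
      simp only [Y, Function.iterate_succ_apply', muYStep, Finset.mem_sup, Finset.mem_univ,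
        true_and] at hv
      obtain ⟨j, hj⟩ := hv
      have hdiv : (j + l * k) / k = l := by
        rw [Nat.add_mul_div_right _ _ hk, Nat.div_eq_of_lt j.isLt, zero_add]
      have hmod : κ (j + l * k) = j := Fin.ext <| by
        simp only [κ, Nat.add_mul_mod_self_right, Nat.mod_eq_of_lt j.isLt]
      refine ⟨j + l * k, ?_, ?_⟩
      · have := j.isLt
        rw [Nat.succ_mul]
        omega
      · simp only [X, hdiv, hmod]
        exact hj
  have hWX : ∀ i, ∀ v ∈ W, ∃ N, v ∈ X i N := by
    intro i v hv
    rw [hW, ← map_nuFix (monotone_nuZStep G.monotone_pre b g), nuZStep, Finset.mem_inf] at hv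
    obtain ⟨l, hl⟩ := mem_muFix.1 (hv i (Finset.mem_univ i))
    obtain ⟨N, -, hN⟩ := hYX i l v hl
    exact ⟨N, hN⟩
  let ρ : Fin m → V → ℕ := fun i v => sInf {N | v ∈ X i N}
  have hρ_le : ∀ {i v N}, v ∈ X i N → ρ i v ≤ N := fun h => Nat.sInf_le h
  have hρ_mem : ∀ {i v}, (∃ N, v ∈ X i N) → v ∈ X i (ρ i v) := fun h => Nat.sInf_mem h
  -- At a guarantee, return to `W` and pursue the next one. Otherwise enter the current `Y`-iterate
  -- if possible: its states have indices below `(ρ / k) * k ≤ ρ`, so the rank drops. Otherwise the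
  -- state is in `b`, and staying in `X` keeps the rank from growing.
  let S : ℕ → V → Finset V := fun q v =>
    if v ∈ g (ι q) ∩ G.pre W then W
    else if v ∈ G.pre (Y (ι q) (ρ (ι q) v / k)) then Y (ι q) (ρ (ι q) v / k)
    else X (ι q) (ρ (ι q) v)
  let upd : ℕ → V → ℕ := fun q v => if v ∈ g (ι q) ∩ G.pre W then q + 1 else q
  obtain ⟨f, hf, hplan⟩ := G.exists_strategy_of_plan 0 upd S (fun q v => ∃ N, v ∈ X (ι q) N) <| by
    intro q v hv
    by_cases h1 : v ∈ g (ι q) ∩ G.pre W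
    · simp only [S, upd, if_pos h1]
      exact ⟨(Finset.mem_inter.1 h1).2, hWX _⟩
    by_cases h2 : v ∈ G.pre (Y (ι q) (ρ (ι q) v / k))
    · simp only [S, upd, if_neg h1, if_pos h2]
      exact ⟨h2, fun v' hv' => let ⟨N, _, hN⟩ := hYX _ _ _ hv'; ⟨N, hN⟩⟩
    · simp only [S, upd, if_neg h1, if_neg h2]
      have hmem := hρ_mem hv
      rw [hX, nuXStep] at hmem
      simp only [Finset.mem_union, h1, h2, or_false] at hmem
      exact ⟨(Finset.mem_inter.1 hmem).1, fun v' hv' => ⟨_, hv'⟩⟩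
  refine ⟨f, hf, fun r hr h0 hfol => ?_⟩
  obtain ⟨q, hq⟩ := hplan r hr (hWX _ _ h0) hfol
  have hstep : ∀ n, (r n ∈ g (ι (q n)) ∧ q (n + 1) = q n + 1) ∨
      (q (n + 1) = q n ∧ (ρ (ι (q n)) (r (n + 1)) < ρ (ι (q n)) (r n) ∨
        r n ∈ b (κ (ρ (ι (q n)) (r n))) ∧ ρ (ι (q n)) (r (n + 1)) ≤ ρ (ι (q n)) (r n))) := by
    intro n
    obtain ⟨hI, hu, hmove⟩ := hq n
    by_cases h1 : r n ∈ g (ι (q n)) ∩ G.pre W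
    · exact Or.inl ⟨(Finset.mem_inter.1 h1).1, hu.trans (if_pos h1)⟩
    refine Or.inr ⟨hu.trans (if_neg h1), ?_⟩
    by_cases h2 : r n ∈ G.pre (Y (ι (q n)) (ρ (ι (q n)) (r n) / k))
    · simp only [S, if_neg h1, if_pos h2] at hmove
      obtain ⟨N, hN, hNX⟩ := hYX _ _ _ hmove
      exact Or.inl ((hρ_le hNX).trans_lt (hN.trans_le (Nat.div_mul_le_self _ _)))
    · simp only [S, if_neg h1, if_neg h2] at hmove
      have hmem := hρ_mem hI
      rw [hX, nuXStep] at hmem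
      simp only [Finset.mem_union, h1, h2, or_false] at hmem
      exact Or.inr ⟨(Finset.mem_inter.1 hmem).2, hρ_le hmove⟩
  -- If the counter stops, the rank is eventually constant, so every later state lies in the one `b
  -- j` it encodes.
  by_cases hinf : ∀ N, ∃ n ≥ N, q (n + 1) = q n + 1
  · left
    intro i N
    obtain ⟨n, hn, hi, hinc⟩ := exists_increment_mod
      (fun n => (hstep n).elim (fun h => Or.inr h.2) fun h => Or.inl h.1) hinf i N
    have hι : ι (q n) = i := Fin.ext hi
    rcases hstep n with h | h
    · exact ⟨n, hn, hι ▸ h.1⟩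
    · omega
  · right
    push Not at hinf
    obtain ⟨N, hN⟩ := hinf
    have hstay : ∀ n ≥ N, q (n + 1) = q n := fun n hn =>
      (hstep n).elim (fun h => absurd h.2 (hN n hn)) And.left
    have hρstep : ∀ n ≥ N, ρ (ι (q (n + 1))) (r (n + 1)) < ρ (ι (q n)) (r n) ∨
        r n ∈ b (κ (ρ (ι (q n)) (r n))) ∧
          ρ (ι (q (n + 1))) (r (n + 1)) ≤ ρ (ι (q n)) (r n) := by
      intro n hn
      rw [hstay n hn]
      exact (hstep n).elim (fun h => absurd h.2 (hN n hn)) And.right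
    obtain ⟨K, hK, hconst⟩ := eventually_eq_of_eventually_succ_le
      (f := fun n => ρ (ι (q n)) (r n)) (N := N)
      fun n hn => (hρstep n hn).elim le_of_lt And.right
    refine ⟨κ (ρ (ι (q K)) (r K)), K, fun n hn => ?_⟩
    have h1 := hconst n hn
    have h2 := hconst (n + 1) (Nat.le_succ_of_le hn)
    rcases hρstep n (hK.trans hn) with h | h
    · omega
    · rw [← h1]
      exact h.1

/-- The inner greatest fixed points contain the limit of the iteration over `Y`. -/
theorem muFix_muYStep_le_nuFix (c : Finset V) (j : Fin k) :
    muFix (muYStep G.pre b c) ≤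
      nuFix (nuXStep G.pre (b j) (G.pre (muFix (muYStep G.pre b c)) ∪ c)) := by
  set Y := muFix (muYStep G.pre b c) with hY
  have hfix : Y = muYStep G.pre b c Y := (map_muFix (monotone_muYStep G.monotone_pre b c)).symm
  intro v hv
  rw [hfix, muYStep, Finset.mem_sup] at hv
  obtain ⟨j', -, hj'⟩ := hv
  have hle : nuFix (nuXStep G.pre (b j') (G.pre Y ∪ c)) ≤ Y := by
    conv_rhs => rw [hfix]
    exact Finset.le_sup (f := fun j => nuFix (nuXStep G.pre (b j) (G.pre Y ∪ c)))
      (Finset.mem_univ j')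
  rw [← map_nuFix (monotone_nuXStep G.monotone_pre _ _), nuXStep, Finset.mem_union] at hj' ⊢
  -- The fixed point for `j'` lies in `Y`, so its `Pre` part is absorbed by `Pre Y`, which is common
  -- to all `j`.
  refine Or.inr (hj'.elim (fun h => ?_) id)
  exact Finset.mem_union_left _ (G.monotone_pre hle (Finset.mem_inter.1 h).1)

/-- Outside the GR(1) fixed point, no strategy of player 0 prevents plays on which some guarantee
fails from some point on although all assumptions hold infinitely often. -/
theorem exists_play_of_notMem_nuFix (hk : 0 < k) {f : List V → V → Option V}
    (hf : G.IsStrategy f) {v : V} (hv : v ∉ nuFix (nuZStep G.pre b g)) :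
    ∃ r, G.IsPlay r ∧ r 0 = v ∧ G.Follows f r ∧
      (∃ i N, ∀ n ≥ N, r n ∉ g i) ∧ ∀ j N, ∃ n ≥ N, r n ∉ b j := by
  classical
  let κ : ℕ → Fin k := fun N => ⟨N % k, Nat.mod_lt _ hk⟩
  let Z : ℕ → Finset V := fun l => (nuZStep G.pre b g)^[l] Finset.univ
  let c : ℕ → Fin m → Finset V := fun z i => g i ∩ G.pre (Z z)
  let Y : ℕ → Fin m → Finset V := fun z i => muFix (muYStep G.pre b (c z i))
  let X : ℕ → Fin m → Fin k → ℕ → Finset V := fun z i j s =>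
    (nuXStep G.pre (b j) (G.pre (Y z i) ∪ c z i))^[s] Finset.univ
  let σ : ℕ → Fin m → Fin k → V → ℕ := fun z i j w => sInf {s | w ∉ X z i j s}
  have hout : ∀ z w, w ∉ Z z → ∃ z' < z, ∃ i, w ∉ Y z' i := by
    intro z w hw
    cases z with
    | zero => exact absurd (Finset.mem_univ w) hw
    | succ z =>
      simp only [Z, Function.iterate_succ_apply', nuZStep, Finset.mem_inf, not_forall] at hw
      obtain ⟨i, -, hi⟩ := hw
      exact ⟨z, Nat.lt_succ_self z, i, hi⟩
  have hYX : ∀ z i j s, Y z i ≤ X z i j s := fun z i j s =>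
    (muFix_muYStep_le_nuFix (c z i) j).trans (nuFix_le_iterate s)
  have hYfix : ∀ z i j, nuFix (nuXStep G.pre (b j) (G.pre (Y z i) ∪ c z i)) ≤ Y z i := by
    intro z i j
    refine le_trans ?_ (map_muFix (monotone_muYStep G.monotone_pre b (c z i))).le
    exact Finset.le_sup (f := fun j => nuFix (nuXStep G.pre (b j) (G.pre (Y z i) ∪ c z i)))
      (Finset.mem_univ j)
  have hσ_mem : ∀ z i j w, w ∉ Y z i → w ∉ X z i j (σ z i j w) := by
    intro z i j w hw
    have : ∃ s, w ∉ X z i j s := by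
      by_contra! h
      exact hw (hYfix z i j (mem_nuFix.2 h))
    exact Nat.sInf_mem this
  have hbase : ∀ z i j w, w ∉ Y z i → w ∉ G.pre (Y z i) ∪ c z i := fun z i j w hw h =>
    hw (hYfix z i j (by
      rw [← map_nuFix (monotone_nuXStep G.monotone_pre _ _)]
      exact Finset.mem_union_right _ h))
  -- The memory `(z, i, n)` holds a level of the `Z`-iteration, the guarantee to be violated, and a
  -- counter whose residue mod `k` is the assumption to visit next. Each move lowers `z`, or avoids
  -- `g i` and either visits that assumption or lowers `σ`, the index of the first `X`-iterate
  -- excluding the state.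
  let Inv : ℕ × Fin m × ℕ → V → Prop := fun q w => w ∉ Y q.1 q.2.1
  let R : ℕ × Fin m × ℕ → V → ℕ × Fin m × ℕ → V → Prop := fun q w q' w' =>
    q'.1 < q.1 ∨ (q'.1 = q.1 ∧ q'.2.1 = q.2.1 ∧ w ∉ g q.2.1 ∧
      ((q'.2.2 = q.2.2 + 1 ∧ w ∉ b (κ q.2.2)) ∨
        (q'.2.2 = q.2.2 ∧ σ q.1 q.2.1 (κ q.2.2) w' < σ q.1 q.2.1 (κ q.2.2) w)))
  obtain ⟨z₁, hz₁⟩ : ∃ z, v ∉ Z z := by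
    by_contra! h
    exact hv (mem_nuFix.2 h)
  obtain ⟨z₀, -, i₀, h₀⟩ := hout z₁ v hz₁
  obtain ⟨r, hr, hr0, hfol, q, hq⟩ := G.exists_play_of_plan Inv R (by
    rintro ⟨z, i, n⟩ w (hw : w ∉ Y z i)
    -- If `Z z` cannot be forced, leaving it lowers `z`. If it can, `w ∈ g i` would put `w` into `c
    -- z i`, hence into `Y z i`.
    by_cases hz : w ∈ G.pre (Z z)
    · have hwc := hbase z i (κ n) w hw
      rw [Finset.mem_union, not_or] at hwc
      have hwg : w ∉ g i := fun h => hwc.2 (Finset.mem_inter.2 ⟨h, hz⟩)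
      by_cases hb : w ∈ b (κ n)
      · have hs := hσ_mem z i (κ n) w hw
        cases hs' : σ z i (κ n) w with
        | zero => rw [hs'] at hs; exact absurd (Finset.mem_univ w) hs
        | succ s =>
          rw [hs'] at hs
          -- Since `w ∈ b`, being outside iterate `s + 1` means that iterate `s` cannot be forced;
          -- leaving it lowers `σ`.
          refine ⟨X z i (κ n) s, fun h => hs ?_, fun w' hw' => ⟨(z, i, n),
            fun h => hw' (hYX z i _ s h), Or.inr ⟨rfl, rfl, hwg, Or.inr ⟨rfl, ?_⟩⟩⟩⟩
          · simp only [X, Function.iterate_succ_apply']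
            exact Finset.mem_union_left _ (Finset.mem_inter.2 ⟨h, hb⟩)
          · change σ z i (κ n) w' < σ z i (κ n) w
            rw [hs']
            exact Nat.lt_succ_of_le (Nat.sInf_le hw')
      · exact ⟨Y z i, hwc.1, fun w' hw' => ⟨(z, i, n + 1), hw',
          Or.inr ⟨rfl, rfl, hwg, Or.inl ⟨rfl, hb⟩⟩⟩⟩
    · refine ⟨Z z, hz, fun w' hw' => ?_⟩
      obtain ⟨z', hz', i', hi'⟩ := hout z w' hw'
      exact ⟨(z', i', n), hi', Or.inl hz'⟩) hf (q₀ := (z₀, i₀, 0)) (v₀ := v) h₀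
  refine ⟨r, hr, hr0, hfol, ?_⟩
  obtain ⟨N, -, hN⟩ := eventually_eq_of_eventually_succ_le (f := fun n => (q n).1) (N := 0)
    fun n _ => (hq n).elim le_of_lt fun h => h.1.le
  have hstep : ∀ n ≥ N, (q (n + 1)).2.1 = (q n).2.1 ∧ r n ∉ g (q n).2.1 ∧
      (((q (n + 1)).2.2 = (q n).2.2 + 1 ∧ r n ∉ b (κ (q n).2.2)) ∨
        ((q (n + 1)).2.2 = (q n).2.2 ∧ σ (q n).1 (q n).2.1 (κ (q n).2.2) (r (n + 1)) <
          σ (q n).1 (q n).2.1 (κ (q n).2.2) (r n))) := by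
    intro n hn
    have h1 := hN n hn
    have h2 := hN (n + 1) (Nat.le_succ_of_le hn)
    exact ((hq n).resolve_left (by omega)).2
  have hi : ∀ n ≥ N, (q n).2.1 = (q N).2.1 := by
    intro n hn
    induction n, hn using Nat.le_induction with
    | base => rfl
    | succ n hn ih => rw [(hstep n hn).1, ih]
  refine ⟨⟨(q N).2.1, N, fun n hn => hi n hn ▸ (hstep n hn).2.1⟩, fun j K => ?_⟩
  obtain ⟨n, hn, hj, hinc⟩ := exists_increment_mod (q := fun n => (q (N + n)).2.2)
    (fun n => (hstep (N + n) (Nat.le_add_right _ _)).2.2.elim (fun h => Or.inr h.1)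
      fun h => Or.inl h.1)
    (by
      -- A counter that stops would make `σ` decrease forever.
      by_contra! hfin
      obtain ⟨L, hL⟩ := hfin
      have hdec : ∀ n ≥ L, (q (N + n + 1)).2.2 = (q (N + n)).2.2 ∧
          σ (q (N + n)).1 (q (N + n)).2.1 (κ (q (N + n)).2.2) (r (N + n + 1)) <
            σ (q (N + n)).1 (q (N + n)).2.1 (κ (q (N + n)).2.2) (r (N + n)) := fun n hn =>
        (hstep (N + n) (Nat.le_add_right _ _)).2.2.resolve_left fun h => hL n hn h.1
      have hlt : ∀ n ≥ L, σ (q (N + (n + 1))).1 (q (N + (n + 1))).2.1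
            (κ (q (N + (n + 1))).2.2) (r (N + (n + 1))) <
          σ (q (N + n)).1 (q (N + n)).2.1 (κ (q (N + n)).2.2) (r (N + n)) := by
        intro n hn
        have e1 : (q (N + (n + 1))).1 = (q (N + n)).1 :=
          (hN _ (by omega)).trans (hN _ (by omega)).symm
        have e2 := (hstep (N + n) (Nat.le_add_right _ _)).1
        obtain ⟨e3, h⟩ := hdec n hn
        rw [← add_assoc] at e1 ⊢
        rw [e1, e2, e3]
        exact h
      obtain ⟨K', hK', hc⟩ := eventually_eq_of_eventually_succ_le
        (f := fun n => σ (q (N + n)).1 (q (N + n)).2.1 (κ (q (N + n)).2.2) (r (N + n)))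
        fun n hn => (hlt n hn).le
      exact absurd (hc (K' + 1) (Nat.le_succ _)) (hlt K' hK').ne)
    j K
  refine ⟨N + n, by omega, ?_⟩
  have hκ : κ (q (N + n)).2.2 = j := Fin.ext hj
  rcases (hstep (N + n) (Nat.le_add_right _ _)).2.2 with h | h
  · exact hκ ▸ h.2
  · have := h.1
    simp only [← add_assoc] at hinc
    omega

end GR1

/-! ### Semantics of the derived LTL operators -/

namespace LTL

variable {P : Type v} (w : ℕ → Finset P) (n : ℕ)

@[simp] theorem sat_atom (p : P) : Sat w (.atom p) n ↔ p ∈ w n := Iff.rfl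

@[simp] theorem sat_neg (φ : LTL P) : Sat w (.neg φ) n ↔ ¬ Sat w φ n := Iff.rfl

@[simp] theorem sat_or (φ ψ : LTL P) : Sat w (.or φ ψ) n ↔ Sat w φ n ∨ Sat w ψ n := Iff.rfl

@[simp] theorem sat_fls : ¬ Sat w .fls n := not_not_intro trivial

@[simp] theorem sat_and (φ ψ : LTL P) : Sat w (.and φ ψ) n ↔ Sat w φ n ∧ Sat w ψ n := by
  simp [LTL.and]

@[simp] theorem sat_imp (φ ψ : LTL P) : Sat w (.imp φ ψ) n ↔ (Sat w φ n → Sat w ψ n) := by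
  simp [LTL.imp, imp_iff_not_or]

@[simp] theorem sat_ev (φ : LTL P) : Sat w (.ev φ) n ↔ ∃ k ≥ n, Sat w φ k :=
  ⟨fun ⟨k, hk, h, _⟩ => ⟨k, hk, h⟩, fun ⟨k, hk, h⟩ => ⟨k, hk, h, fun _ _ _ => trivial⟩⟩

@[simp] theorem sat_alw (φ : LTL P) : Sat w (.alw φ) n ↔ ∀ k ≥ n, Sat w φ k := by
  simp [LTL.alw]

@[simp] theorem sat_bigAnd {k : ℕ} (φ : Fin k → LTL P) :
    Sat w (.bigAnd φ) n ↔ ∀ i, Sat w (φ i) n := by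
  induction k with
  | zero => exact ⟨fun _ i => i.elim0, fun _ => trivial⟩
  | succ k ih =>
    have := ih fun i => φ i.succ
    simp only [bigAnd, List.ofFn_succ, List.foldr_cons, sat_and, Fin.forall_fin_succ] at this ⊢
    rw [this]

@[simp] theorem sat_bigOr {k : ℕ} (φ : Fin k → LTL P) :
    Sat w (.bigOr φ) n ↔ ∃ i, Sat w (φ i) n := by
  induction k with
  | zero => exact ⟨fun h => absurd h (sat_fls w n), fun ⟨i, _⟩ => i.elim0⟩
  | succ k ih =>
    have := ih fun i => φ i.succ
    simp only [bigOr, List.ofFn_succ, List.foldr_cons, sat_or, Fin.exists_fin_succ] at this ⊢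
    rw [this]

end LTL

/-! ### The winning conditions of the mode-target game and its embedding -/

section WinningConditions

variable {V : Type u} {P : Type v} {m : ℕ} {t : Fin m → ℕ} {M : Fin m → P}
  {T : (i : Fin m) → Fin (t i) → P}

theorem sat_paddedTarget (w : ℕ → Finset P) (i : Fin m) (j n : ℕ) :
    LTL.Sat w (paddedTarget T i j) n ↔ ∃ h : j < t i, T i ⟨j, h⟩ ∈ w n := by
  unfold paddedTarget
  split_ifs with h <;> simp [h]

theorem sat_mtFormula (w : ℕ → Finset P) :
    LTL.Sat w (mtFormula M T) 0 ↔
      ∀ i, (∃ N, ∀ n ≥ N, M i ∈ w n) → ∃ j, ∃ N, ∀ n ≥ N, T i j ∈ w n := by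
  simp [mtFormula]

theorem sat_gr1Formula (w : ℕ → Finset P) :
    LTL.Sat w (gr1Formula M T) 0 ↔
      ((∀ j : Fin (maxTargets t), ∀ N, ∃ n ≥ N, ∀ i, M i ∈ w n →
        ¬ ∃ h : j < t i, T i ⟨j, h⟩ ∈ w n) → ∀ i N, ∃ n ≥ N, M i ∉ w n) := by
  simp only [gr1Formula, LTL.sat_imp, LTL.sat_bigAnd, LTL.sat_alw, LTL.sat_ev, LTL.sat_or,
    LTL.sat_neg, LTL.sat_atom, sat_paddedTarget, ← imp_iff_not_or, ge_iff_le, Nat.zero_le,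
    true_imp_iff]

/-- On words with mutually exclusive modes, the two winning conditions agree. -/
theorem sat_mtFormula_iff_sat_gr1Formula {w : ℕ → Finset P}
    (hw : ∀ n i, M i ∈ w n → ∀ j, j ≠ i → M j ∉ w n) :
    LTL.Sat w (mtFormula M T) 0 ↔ LTL.Sat w (gr1Formula M T) 0 := by
  rw [sat_mtFormula, sat_gr1Formula]
  constructor
  · intro h hA i N
    by_contra! hM
    obtain ⟨j, N', hT⟩ := h i ⟨N, hM⟩
    have hj : (j : ℕ) < maxTargets t := j.isLt.trans_le (Finset.le_sup (Finset.mem_univ i))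
    obtain ⟨n, hn, hout⟩ := hA ⟨j, hj⟩ (max N N')
    exact hout i (hM n (le_trans (le_max_left _ _) hn))
      ⟨j.isLt, hT n (le_trans (le_max_right _ _) hn)⟩
  · rintro h i ⟨N, hM⟩
    by_contra! hT
    obtain ⟨n, hn, hout⟩ := h (fun j N' => by
      have hlate : ∃ n ≥ max N N', ¬ ∃ h : j < t i, T i ⟨j, h⟩ ∈ w n := by
        by_cases hj : (j : ℕ) < t i
        · obtain ⟨n, hn, hnT⟩ := hT ⟨j, hj⟩ (max N N')
          exact ⟨n, hn, fun ⟨_, h⟩ => hnT h⟩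
        · exact ⟨_, le_rfl, fun ⟨h, _⟩ => hj h⟩
      obtain ⟨n, hn, hnT⟩ := hlate
      refine ⟨n, le_trans (le_max_right _ _) hn, fun l hl => ?_⟩
      -- Exclusivity enters here: late enough, the only active mode is `i`.
      have hli : l = i := by
        by_contra hne
        exact hw n i (hM n (le_trans (le_max_left _ _) hn)) l hne hl
      exact hli ▸ hnT) i N
    exact hout (hM n hn)

variable [Fintype V] [DecidableEq V] [DecidableEq P] (G : GameGraph V P)

omit [DecidableEq V] [DecidableEq P] in
theorem mem_winningSet {φ : LTL P} {v : V} :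
    v ∈ G.winningSet φ ↔ ∃ f, G.IsStrategy f ∧ G.IsWinningFrom φ f v := by
  simp [GameGraph.winningSet]

omit [DecidableEq V] [DecidableEq P] in
theorem winningSet_congr {φ ψ : LTL P}
    (h : ∀ r, G.IsPlay r →
      (LTL.Sat (fun k => G.label (r k)) φ 0 ↔ LTL.Sat (fun k => G.label (r k)) ψ 0)) :
    G.winningSet φ = G.winningSet ψ := by
  ext v
  rw [mem_winningSet, mem_winningSet]
  exact exists_congr fun f => and_congr_right fun _ => forall_congr' fun r =>
    forall_congr' fun hr => by rw [h r hr]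

omit [DecidableEq V] in
theorem sat_gr1Formula_play (r : ℕ → V) :
    LTL.Sat (fun k => G.label (r k)) (gr1Formula M T) 0 ↔
      ((∀ j : Fin (maxTargets t), ∀ N, ∃ n ≥ N, r n ∉ onTargetStates G M T j) →
        ∀ i N, ∃ n ≥ N, r n ∈ notModeStates G M i) := by
  rw [sat_gr1Formula]
  simp [onTargetStates, notModeStates]

variable (M T)

/-- No determinacy theorem is needed: outside the fixed point, a spoiling play is built against each
strategy separately. -/
theorem winningSet_gr1Formula (hm : 0 < m) (hk : 0 < maxTargets t) :
    G.winningSet (gr1Formula M T) =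
      nuFix (nuZStep G.pre (fun j : Fin (maxTargets t) => onTargetStates G M T j)
        (notModeStates G M)) := by
  ext v
  rw [mem_winningSet]
  constructor
  · rintro ⟨f, hf, hwin⟩
    by_contra hv
    obtain ⟨r, hr, h0, hfol, ⟨i, N, hi⟩, hA⟩ := exists_play_of_notMem_nuFix hk hf hv
    obtain ⟨n, hn, h⟩ := (sat_gr1Formula_play G r).1 (hwin r hr h0 hfol) hA i N
    exact hi n hn h
  · intro hv
    obtain ⟨f, hf, hwin⟩ := exists_strategy_of_mem_nuFix (G := G)
      (b := fun j : Fin (maxTargets t) => onTargetStates G M T j) (g := notModeStates G M) hm hk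
    refine ⟨f, hf, fun r hr h0 hfol => (sat_gr1Formula_play G r).2 fun hA => ?_⟩
    rcases hwin r hr (h0 ▸ hv) hfol with h | ⟨j, N, hj⟩
    · exact h
    · obtain ⟨n, hn, hout⟩ := hA j N
      exact absurd (hj n hn) hout

theorem gr1EmbFixedPoint_eq :
    gr1EmbFixedPoint G M T =
      nuFix (nuZStep G.pre (fun j : Fin (maxTargets t) => onTargetStates G M T j)
        (notModeStates G M)) := by
  simp only [gr1EmbFixedPoint, Finset.union_assoc]
  rfl

end WinningConditions

end ModeTarget

theorem theorem3 :
    ∃ C : ℕ, ∀ (V : Type*) (P : Type*) [Fintype V] [DecidableEq V] [DecidableEq P] [Nonempty V]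
      (G : GameGraph V P) (m : ℕ) (t : Fin m → ℕ) (M : Fin m → P)
      (T : (i : Fin m) → Fin (t i) → P),
      ModesExclusive G M → (∃ i, 0 < t i) →
        (gr1Emb G M T).result G.pre = gr1EmbFixedPoint G M T ∧
        (gr1Emb G M T).result G.pre = G.winningSet (gr1Formula M T) ∧
        (gr1Emb G M T).result G.pre = G.winningSet (mtFormula M T) ∧
        (gr1Emb G M T).preCount G.pre ≤ C * (m * maxTargets t * Fintype.card V ^ 2) := by
  refine ⟨12, fun V P _ _ _ _ G m t M T hexcl ⟨i, hi⟩ => ?_⟩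
  have hk : 0 < maxTargets t := hi.trans_le (Finset.le_sup (Finset.mem_univ i))
  have hres := result_gr1Algorithm G.monotone_pre
    (fun j : Fin (maxTargets t) => onTargetStates G M T j) (notModeStates G M)
  have hwin := winningSet_gr1Formula M T G i.pos hk
  refine ⟨hres.trans (gr1EmbFixedPoint_eq M T G).symm, hres.trans hwin.symm, ?_,
    preCount_gr1Algorithm_le G.monotone_pre _ _ i.pos hk⟩
  refine hres.trans (hwin.symm.trans (winningSet_congr G fun r _ => ?_))
  exact (sat_mtFormula_iff_sat_gr1Formula fun n => hexcl (r n)).symm
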